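/- **Theorem 1.1.** Let $\kappa$ be a strongly compact cardinal (uncountable, regular, and such that every proper $\kappa$-complete filter on a set extends to a $\kappa$-complete ultrafilter), let $(K,\prec_K)$ be an abstract elementary class in a vocabulary $\tau$ with Löwenheim–Skolem number $LS(K)<\kappa$ (where, as usual, $LS(K)\ge|\tau|+\aleph_0$), and let $\mu<\kappa$ be a cardinal. If $P$ is any one of the properties AP, JEP, DAP, DJEP, NDJEP below and $K$ has $P$ for models with cardinality in $[\mu,\kappa)$, then $K$ has $P$ for all models of cardinality $\geq\mu$. Here a $K$-embedding is an embedding of $\tau$-structures whose image is a strong substructure ($\prec_K$) of its codomain, and for a class $\mathcal F$ of cardinals $K_{\mathcal F}$ is the class of $M\in K$ with $|M|\in\mathcal F$. For models with cardinality in $\mathcal F$: * **AP** (amalgamation): for all $M_0,M_1,M_2\in K_{\mathcal F}$ and $K$-embeddings $f_\ell:M_0\to M_\ell$ ($\ell=1,2$) there are $N\in K$ and $K$-embeddings $g_\ell:M_\ell\to N$ with $g_1f_1=g_2f_2$. * **DAP** (disjoint amalgamation): the same, with in addition $g_1(M_1)\cap g_2(M_2)=g_1f_1(M_0)$. * **JEP**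 (joint embedding): for all $M_1,M_2\in K_{\mathcal F}$ there are $N\in K$ and $K$-embeddings $g_\ell:M_\ell\to N$. * **DJEP** (disjoint joint embedding): the same, with in addition $g_1(M_1)\cap g_2(M_2)=\emptyset$. * **NDJEP** (nearly disjoint joint embedding): as JEP, with in addition $g_1(M_1)\cap g_2(M_2)$ contained in the set of values in $N$ of the closed $\tau$-terms. -/

import Mathlib

open Cardinal
open scoped FirstOrder

universe u

/-- `κ` is strongly compact: it is an uncountable regular cardinal and every (proper)
`κ`-complete filter on any set extends to a `κ`-complete ultrafilter. -/
structure IsStronglyCompact (κ : Cardinal.{u}) : Prop where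
  aleph0_lt : ℵ₀ < κ
  isRegular : κ.IsRegular
  exists_ultrafilter : ∀ (S : Type u) (F : Filter S), F.NeBot → CardinalInterFilter F κ →
    ∃ U : Ultrafilter S, (U : Filter S) ≤ F ∧ CardinalInterFilter (U : Filter S) κ

/-- For substructures `S`, `T` of one `L`-structure: `S ⊆ T`, and `S`, seen as a substructure of
the structure `T`, satisfies the given relation `R` (`R A` reads: `A` is a strong
substructure of the structure it lives in). -/
def StrongWithin {L : FirstOrder.Language.{u, u}}
    (R : {N : Type u} → [L.Structure N] → L.Substructure N → Prop)
    {N : Type u} [L.Structure N] (S T : L.Substructure N) : Prop :=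
  S ≤ T ∧ R (S.comap T.subtype.toHom)

/-- An abstract elementary class in the vocabulary `L`: a class `Mod` of `L`-structures together
with a strong substructure relation `≺` (`Strong S`, for a substructure `S` of `N`,
reads `S ≺ N`), satisfying the usual axioms. -/
structure AEC (L : FirstOrder.Language.{u, u}) where
  /-- membership of an `L`-structure in the class -/
  Mod : (M : Type u) → [L.Structure M] → Prop
  /-- the strong substructure relation `S ≺ N` -/
  Strong : {N : Type u} → [L.Structure N] → L.Substructure N → Prop
  /-- `≺` relates members of the class only -/
  mod_of_strong : ∀ {N : Type u} [L.Structure N] (S : L.Substructure N),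
    Strong S → Mod S ∧ Mod N
  /-- the class is closed under isomorphism -/
  mod_of_equiv : ∀ {M N : Type u} [L.Structure M] [L.Structure N],
    (M ≃[L] N) → Mod M → Mod N
  /-- `≺` is closed under isomorphism -/
  strong_of_equiv : ∀ {M N : Type u} [L.Structure M] [L.Structure N] (e : M ≃[L] N)
    (S : L.Substructure M), Strong S → Strong (S.map e.toHom)
  /-- `≺` is reflexive on the class -/
  strong_refl : ∀ {N : Type u} [L.Structure N], Mod N → Strong (⊤ : L.Substructure N)
  /-- `≺` is transitive -/
  strong_trans : ∀ {N : Type u} [L.Structure N] (S T : L.Substructure N),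
    StrongWithin Strong S T → Strong T → Strong S
  /-- coherence: if `S ≺ N`, `T ≺ N` and `S ⊆ T`, then `S ≺ T` -/
  coherence : ∀ {N : Type u} [L.Structure N] (S T : L.Substructure N),
    Strong S → Strong T → S ≤ T → StrongWithin Strong S T
  /-- the union of a continuous well-ordered `≺`-increasing chain is in the class and is a
  strong extension of each member of the chain (the chain is realized as a chain of
  substructures of some `L`-structure, which need not be in the class) -/
  chain_union : ∀ {N : Type u} [L.Structure N] {ι : Type u} [LinearOrder ι] [WellFoundedLT ι]
    [Nonempty ι] (S : ι → L.Substructure N),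
    (∀ i j, i ≤ j → StrongWithin Strong (S i) (S j)) →
    (∀ i, Order.IsSuccLimit i → S i = ⨆ j : Set.Iio i, S j) →
    Mod (⨆ i, S i : L.Substructure N) ∧ ∀ i, StrongWithin Strong (S i) (⨆ i, S i)
  /-- if moreover each member of the chain is `≺ N`, then so is the union -/
  chain_union_strong : ∀ {N : Type u} [L.Structure N] {ι : Type u} [LinearOrder ι]
    [WellFoundedLT ι] [Nonempty ι] (S : ι → L.Substructure N),
    (∀ i j, i ≤ j → StrongWithin Strong (S i) (S j)) →
    (∀ i, Order.IsSuccLimit i → S i = ⨆ j : Set.Iio i, S j) →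
    (∀ i, Strong (S i)) → Strong (⨆ i, S i)
  /-- downward Löwenheim–Skolem: some cardinal serves as a Löwenheim–Skolem number -/
  exists_ls : ∃ lam : Cardinal.{u}, ∀ {N : Type u} [L.Structure N], Mod N → ∀ A : Set N,
    ∃ S : L.Substructure N, Strong S ∧ A ⊆ S ∧ #S ≤ #A + lam

namespace AEC

variable {L : FirstOrder.Language.{u, u}}

/-- The Löwenheim–Skolem number of `K`: the least infinite cardinal `lam`, at least the size of the
vocabulary, such that every subset `A` of a model `N` of `K` is contained in
some `S ≺ N` with `|S| ≤ |A| + lam`. -/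
noncomputable def lsNumber (K : AEC L) : Cardinal.{u} :=
  sInf {lam : Cardinal.{u} | ℵ₀ ≤ lam ∧ L.card ≤ lam ∧
    ∀ (N : Type u) [L.Structure N], K.Mod N → ∀ A : Set N,
      ∃ S : L.Substructure N, K.Strong S ∧ A ⊆ S ∧ #S ≤ #A + lam}

/-- An `L`-embedding is a `K`-embedding if its range is a strong substructure of its codomain. -/
def IsKEmbedding (K : AEC L) {M N : Type u} [L.Structure M] [L.Structure N]
    (f : M ↪[L] N) : Prop :=
  K.Strong f.toHom.range

/-- Amalgamation property for the models of `K` with cardinality in `C`. -/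
def AP (K : AEC L) (C : Set Cardinal.{u}) : Prop :=
  ∀ (M₀ M₁ M₂ : Type u) [L.Structure M₀] [L.Structure M₁] [L.Structure M₂],
    K.Mod M₀ → K.Mod M₁ → K.Mod M₂ → #M₀ ∈ C → #M₁ ∈ C → #M₂ ∈ C →
    ∀ (f₁ : M₀ ↪[L] M₁) (f₂ : M₀ ↪[L] M₂), K.IsKEmbedding f₁ → K.IsKEmbedding f₂ →
    ∃ (N : Type u) (_ : L.Structure N) (g₁ : M₁ ↪[L] N) (g₂ : M₂ ↪[L] N),
      K.IsKEmbedding g₁ ∧ K.IsKEmbedding g₂ ∧ g₁.comp f₁ = g₂.comp f₂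

/-- Disjoint amalgamation property for the models of `K` with cardinality in `C`: the ranges of the
amalgamating embeddings meet only in the image of the base. -/
def DAP (K : AEC L) (C : Set Cardinal.{u}) : Prop :=
  ∀ (M₀ M₁ M₂ : Type u) [L.Structure M₀] [L.Structure M₁] [L.Structure M₂],
    K.Mod M₀ → K.Mod M₁ → K.Mod M₂ → #M₀ ∈ C → #M₁ ∈ C → #M₂ ∈ C →
    ∀ (f₁ : M₀ ↪[L] M₁) (f₂ : M₀ ↪[L] M₂), K.IsKEmbedding f₁ → K.IsKEmbedding f₂ →
    ∃ (N : Type u) (_ : L.Structure N) (g₁ : M₁ ↪[L] N) (g₂ : M₂ ↪[L] N),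
      K.IsKEmbedding g₁ ∧ K.IsKEmbedding g₂ ∧ g₁.comp f₁ = g₂.comp f₂ ∧
      Set.range g₁ ∩ Set.range g₂ = Set.range (g₁.comp f₁)

/-- Joint embedding property for the models of `K` with cardinality in `C`. -/
def JEP (K : AEC L) (C : Set Cardinal.{u}) : Prop :=
  ∀ (M₁ M₂ : Type u) [L.Structure M₁] [L.Structure M₂],
    K.Mod M₁ → K.Mod M₂ → #M₁ ∈ C → #M₂ ∈ C →
    ∃ (N : Type u) (_ : L.Structure N) (g₁ : M₁ ↪[L] N) (g₂ : M₂ ↪[L] N),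
      K.IsKEmbedding g₁ ∧ K.IsKEmbedding g₂

/-- Disjoint joint embedding property for the models of `K` with cardinality in `C`. -/
def DJEP (K : AEC L) (C : Set Cardinal.{u}) : Prop :=
  ∀ (M₁ M₂ : Type u) [L.Structure M₁] [L.Structure M₂],
    K.Mod M₁ → K.Mod M₂ → #M₁ ∈ C → #M₂ ∈ C →
    ∃ (N : Type u) (_ : L.Structure N) (g₁ : M₁ ↪[L] N) (g₂ : M₂ ↪[L] N),
      K.IsKEmbedding g₁ ∧ K.IsKEmbedding g₂ ∧ Disjoint (Set.range g₁) (Set.range g₂)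

/-- Nearly disjoint joint embedding property for the models of `K` with cardinality in `C`: the
ranges meet only in elements named by closed terms, which no embeddings can separate. -/
def NDJEP (K : AEC L) (C : Set Cardinal.{u}) : Prop :=
  ∀ (M₁ M₂ : Type u) [L.Structure M₁] [L.Structure M₂],
    K.Mod M₁ → K.Mod M₂ → #M₁ ∈ C → #M₂ ∈ C →
    ∃ (N : Type u) (_ : L.Structure N) (g₁ : M₁ ↪[L] N) (g₂ : M₂ ↪[L] N),
      K.IsKEmbedding g₁ ∧ K.IsKEmbedding g₂ ∧
      Set.range g₁ ∩ Set.range g₂ ⊆ (FirstOrder.Language.Substructure.closure L (∅ : Set N) : Set N)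

end AEC

/-! Let `I` be the set of pairs (for amalgamation, compatible triples) of strong submodels with
cardinality in `[μ, κ)`. Downward Löwenheim–Skolem makes `I` `κ`-directed, so its order filter
`atTop` is `κ`-complete and extends to a `κ`-complete ultrafilter `U`. The hypothesis solves the
problem at each `i : I` in some model `N i`, and the maps `m ↦ [g i m]` embed the given large models
into the ultraproduct of the `N i`. Agreement of two such classes is agreement on a `U`-large set.
So identifications forced on a tail of `I` persist, and identifications permitted at no index do not
arise.

It remains to see that the ultraproduct is in `K` and that the maps are `K`-embeddings, for which
the AEC axioms suffice. If each `T i ≺ N i` has size at most the Löwenheim–Skolem number, the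
ultraproduct of the `T i` has size below `κ`. It is then described by fewer than `κ` conditions and
is copied exactly by `T i` for `U`-almost all `i`. Coherence in one `N i` therefore gives `≺`
between any two nested such internal submodels (`strongWithin_of_mem_smallInternal`). They form a
directed system with union the whole ultraproduct, and AECs are closed under directed unions
(`strongWithin_sSup_of_directedOn`), so each is strong in it. Small strong submodels of a large
model are sent onto internal ones, and the range of the embedding is their directed union
(`exists_isKEmbedding_ultraproduct`). -/

namespace FirstOrder.Language.Substructure

variable {L : FirstOrder.Language.{u, u}} {M N : Type u} [L.Structure M] [L.Structure N]

theorem map_comap_subtype {S T : L.Substructure N} (h : S ≤ T) :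
    (S.comap T.subtype.toHom).map T.subtype.toHom = S := by
  ext x
  simp only [mem_map, mem_comap]
  exact ⟨fun ⟨y, hy, e⟩ => e ▸ hy, fun hx => ⟨⟨x, h hx⟩, hx, rfl⟩⟩

theorem comap_subtype_eq_range_inclusion {S T : L.Substructure N} (h : S ≤ T) :
    S.comap T.subtype.toHom = (inclusion h).toHom.range := by
  ext x
  simp only [mem_comap, Hom.mem_range]
  exact ⟨fun hx => ⟨⟨x.1, hx⟩, rfl⟩, fun ⟨y, hy⟩ => hy ▸ y.2⟩

end FirstOrder.Language.Substructure

/-! ### Calculus of `K`-embeddings and of relative strength -/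

namespace AEC

open FirstOrder FirstOrder.Language FirstOrder.Language.Substructure

variable {L : FirstOrder.Language.{u, u}} (K : AEC L)
variable {M N P : Type u} [L.Structure M] [L.Structure N] [L.Structure P]

theorem isKEmbedding_comp_equiv_left {f : M ↪[L] N} (e : N ≃[L] P) (hf : K.IsKEmbedding f) :
    K.IsKEmbedding (e.toEmbedding.comp f) := by
  have := K.strong_of_equiv e _ hf
  rw [← Hom.range_comp] at this
  exact this

theorem isKEmbedding_comp_equiv_right {f : N ↪[L] P} (e : M ≃[L] N) (hf : K.IsKEmbedding f) :
    K.IsKEmbedding (f.comp e.toEmbedding) := by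
  have : (f.comp e.toEmbedding).toHom.range = f.toHom.range := by
    ext x
    simp only [Hom.mem_range]
    exact ⟨fun ⟨y, hy⟩ => ⟨e y, hy⟩, fun ⟨y, hy⟩ => ⟨e.symm y, by
      rw [← hy]; change f (e (e.symm y)) = f y; simp⟩⟩
  rw [IsKEmbedding, this]
  exact hf

theorem strong_iff_isKEmbedding_subtype {S : L.Substructure N} :
    K.Strong S ↔ K.IsKEmbedding S.subtype := by
  rw [IsKEmbedding, range_subtype]

theorem strongWithin_iff_inclusion {S T : L.Substructure N} :
    StrongWithin K.Strong S T ↔ ∃ h : S ≤ T, K.IsKEmbedding (inclusion h) :=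
  ⟨fun h => ⟨h.1, by rw [IsKEmbedding, ← comap_subtype_eq_range_inclusion]; exact h.2⟩,
    fun ⟨h, h'⟩ => ⟨h, by rw [comap_subtype_eq_range_inclusion h]; exact h'⟩⟩

/-- Lets closure under isomorphism carry strength between `N` and its copy inside `P`, where
transitivity and coherence are formulated. -/
theorem map_equivRange_range (f : M ↪[L] N) (g : N ↪[L] P) :
    f.toHom.range.map g.equivRange.toHom =
      (g.comp f).toHom.range.comap g.toHom.range.subtype.toHom := by
  ext ⟨x, hx⟩
  simp only [mem_map, mem_comap, Hom.mem_range]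
  constructor
  · rintro ⟨_, ⟨y, rfl⟩, h⟩
    exact ⟨y, congrArg Subtype.val h⟩
  · rintro ⟨y, h⟩
    exact ⟨_, ⟨y, rfl⟩, Subtype.ext h⟩

theorem IsKEmbedding.comp {K : AEC L} {f : M ↪[L] N} {g : N ↪[L] P}
    (hg : K.IsKEmbedding g) (hf : K.IsKEmbedding f) : K.IsKEmbedding (g.comp f) := by
  refine K.strong_trans _ g.toHom.range ⟨Hom.range_comp_le_range f.toHom g.toHom, ?_⟩ hg
  rw [← map_equivRange_range]
  exact K.strong_of_equiv _ _ hf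

theorem IsKEmbedding.of_comp {K : AEC L} {f : M ↪[L] N} {g : N ↪[L] P}
    (hg : K.IsKEmbedding g) (hf : K.IsKEmbedding (g.comp f)) : K.IsKEmbedding f := by
  have h := (K.coherence _ _ hf hg (Hom.range_comp_le_range f.toHom g.toHom)).2
  rw [← map_equivRange_range] at h
  have h' := K.strong_of_equiv g.equivRange.symm _ h
  rw [Substructure.map_map] at h'
  rw [IsKEmbedding]
  convert h'
  ext x
  simp only [mem_map]
  refine ⟨fun hx => ⟨x, hx, g.equivRange.symm_apply_apply x⟩, fun ⟨y, hy, e⟩ => ?_⟩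
  have e' : y = x := (g.equivRange.symm_apply_apply y).symm.trans e
  exact e' ▸ hy

theorem strong_map {f : M ↪[L] N} (hf : K.IsKEmbedding f) {S : L.Substructure M}
    (hS : K.Strong S) : K.Strong (S.map f.toHom) := by
  have := hf.comp (K.strong_iff_isKEmbedding_subtype.1 hS)
  rw [IsKEmbedding] at this
  convert this
  ext x
  simp only [mem_map, Hom.mem_range]
  exact ⟨fun ⟨y, hy, e⟩ => ⟨⟨y, hy⟩, e⟩, fun ⟨y, e⟩ => ⟨y, y.2, e⟩⟩

/-- Relative strength depends only on the pair of structures, not on the ambient one. Hence `f` may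
be any `L`-embedding; it is not required to be a `K`-embedding. -/
theorem strongWithin_map_iff (f : M ↪[L] N) {S T : L.Substructure M} :
    StrongWithin K.Strong (S.map f.toHom) (T.map f.toHom) ↔ StrongWithin K.Strong S T := by
  simp only [strongWithin_iff_inclusion]
  have hle : S.map f.toHom ≤ T.map f.toHom ↔ S ≤ T :=
    map_le_map_iff_of_injective f.injective
  have key : ∀ (h : S ≤ T) (h' : S.map f.toHom ≤ T.map f.toHom),
      (inclusion h').comp (f.substructureEquivMap S).toEmbedding =
        (f.substructureEquivMap T).toEmbedding.comp (inclusion h) := fun h h' => by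
    ext x; rfl
  constructor
  · rintro ⟨h', hk⟩
    refine ⟨hle.1 h', IsKEmbedding.of_comp (g := (f.substructureEquivMap T).toEmbedding) ?_ ?_⟩
    · have := K.mod_of_strong _ hk
      rw [IsKEmbedding]
      have h2 : (f.substructureEquivMap T).toEmbedding.toHom.range = ⊤ :=
        (f.substructureEquivMap T).toHom_range
      rw [h2]
      exact K.strong_refl this.2
    · rw [← key _ h']
      exact K.isKEmbedding_comp_equiv_right _ hk
  · rintro ⟨h, hk⟩
    refine ⟨hle.2 h, ?_⟩
    have h1 := K.isKEmbedding_comp_equiv_left (f.substructureEquivMap T) hk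
    rw [← key h (hle.2 h)] at h1
    have h2 := K.isKEmbedding_comp_equiv_right (f.substructureEquivMap S).symm h1
    convert h2
    ext x
    obtain ⟨y, rfl⟩ := (f.substructureEquivMap S).surjective x
    change _ = (((f.substructureEquivMap S) ((f.substructureEquivMap S).symm
      (f.substructureEquivMap S y)) : _) : N)
    rw [FirstOrder.Language.Equiv.symm_apply_apply]
    rfl

theorem strongWithin_top_iff {S : L.Substructure N} :
    StrongWithin K.Strong S ⊤ ↔ K.Strong S := by
  have key : S.map (topEquiv (L := L) (M := N)).symm.toHom =
      S.comap (⊤ : L.Substructure N).subtype.toHom := by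
    ext x
    simp only [mem_map, mem_comap]
    refine ⟨fun ⟨y, hy, e⟩ => e ▸ hy, fun hx => ⟨x.1, hx, rfl⟩⟩
  constructor
  · rintro ⟨-, h⟩
    have := K.strong_of_equiv topEquiv _ h
    convert this
    exact (map_comap_subtype le_top).symm
  · intro h
    refine ⟨le_top, ?_⟩
    rw [← key]
    exact K.strong_of_equiv _ _ h

variable {K}

theorem StrongWithin.trans {R S T : L.Substructure N} (h : StrongWithin K.Strong R S)
    (h' : StrongWithin K.Strong S T) : StrongWithin K.Strong R T := by
  rw [strongWithin_iff_inclusion] at *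
  obtain ⟨h1, h2⟩ := h
  obtain ⟨h3, h4⟩ := h'
  exact ⟨h1.trans h3, h4.comp h2⟩

theorem strongWithin_comap_subtype_iff {R S T : L.Substructure N} (h : R ≤ T) (h' : S ≤ T) :
    StrongWithin K.Strong (R.comap T.subtype.toHom) (S.comap T.subtype.toHom) ↔
      StrongWithin K.Strong R S := by
  rw [← K.strongWithin_map_iff T.subtype, map_comap_subtype h, map_comap_subtype h']

variable (K)

/-- The union axiom is applied with `T` itself as ambient structure, so `T` need not be strong in
`N`. -/
theorem strongWithin_iSup_of_chain {ι : Type u} [LinearOrder ι] [WellFoundedLT ι] [Nonempty ι]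
    (S : ι → L.Substructure N) (T : L.Substructure N)
    (hS : ∀ i j, i ≤ j → StrongWithin K.Strong (S i) (S j))
    (hlim : ∀ i, Order.IsSuccLimit i → S i = ⨆ j : Set.Iio i, S j)
    (hT : ∀ i, StrongWithin K.Strong (S i) T) : StrongWithin K.Strong (⨆ i, S i) T := by
  have hcomap : ∀ {κ : Type u} (R : κ → L.Substructure N), (∀ i, R i ≤ T) →
      (⨆ i, R i).comap T.subtype.toHom = ⨆ i, (R i).comap T.subtype.toHom := fun R hR => by
    apply map_injective_of_injective (f := T.subtype.toHom) T.subtype.injective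
    rw [map_comap_subtype (iSup_le hR), Substructure.map_iSup]
    exact iSup_congr fun i => (map_comap_subtype (hR i)).symm
  refine ⟨iSup_le fun i => (hT i).1, ?_⟩
  rw [hcomap S fun i => (hT i).1]
  refine K.chain_union_strong _ (fun i j hij => ?_) (fun i hi => ?_) fun i => (hT i).2
  · exact (strongWithin_comap_subtype_iff (hT i).1 (hT j).1).2 (hS i j hij)
  · rw [hlim i hi, hcomap]
    exact fun j => (hT j).1

end AEC

/-! ### From well-ordered chains to directed unions -/

theorem exists_finset_upperBound_monotone (X : Type u) [Preorder X] [IsDirectedOrder X]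
    [Nonempty X] : ∃ F : Finset X → X, Monotone F ∧ ∀ s, ∀ x ∈ s, x ≤ F s := by
  classical
  -- One step of the recursion: a bound for the elements of `s` and for the finitely many values
  -- already chosen on proper subsets, which yields monotonicity.
  have H_exists : ∀ (s : Finset X) (ih : ∀ t ⊂ s, X),
      ∃ y, (∀ x ∈ s, x ≤ y) ∧ ∀ t (ht : t ⊂ s), ih t ht ≤ y := by
    intro s ih
    obtain ⟨y, hy⟩ := Finset.exists_le (s ∪ s.ssubsets.attach.image
      (fun t : {t // t ∈ s.ssubsets} => ih t.1 (Finset.mem_ssubsets.1 t.2)))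
    exact ⟨y, fun x hx => hy x (Finset.mem_union_left _ hx), fun t ht => hy _
      (Finset.mem_union_right _ (Finset.mem_image.2
        ⟨⟨t, Finset.mem_ssubsets.2 ht⟩, Finset.mem_attach _ _, rfl⟩))⟩
  choose H H_spec using H_exists
  refine ⟨fun s => Finset.strongInduction H s, fun s t hst => ?_, fun s x hx => ?_⟩
  · rcases hst.eq_or_ssubset with rfl | h
    · exact le_rfl
    · change _ ≤ Finset.strongInduction H t
      rw [Finset.strongInduction_eq H t]
      exact (H_spec t fun t' _ => Finset.strongInduction H t').2 s h
  · change _ ≤ Finset.strongInduction H s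
    rw [Finset.strongInduction_eq H s]
    exact (H_spec s fun t' _ => Finset.strongInduction H t').1 x hx

namespace AEC

open FirstOrder FirstOrder.Language FirstOrder.Language.Substructure

variable {L : FirstOrder.Language.{u, u}} (K : AEC L) {N : Type u} [L.Structure N]

/-- Induction on `#Y`: an infinite `Y` is a continuous increasing union of smaller sets, and the
corresponding partial unions form a continuous chain. The two conclusions are proved together
because the second, at smaller sets, is what makes that chain `≺`-increasing. -/
theorem strongWithin_iSup_finset_subset {X : Type u} (S : Finset X → L.Substructure N)
    (hS : ∀ s t, s ≤ t → StrongWithin K.Strong (S s) (S t)) (c : Cardinal.{u}) :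
    ∀ Y : Set X, #Y = c →
      (∀ s : Finset X, ↑s ⊆ Y →
        StrongWithin K.Strong (S s) (⨆ t : {t : Finset X // (t : Set X) ⊆ Y}, S t)) ∧
      ∀ T : L.Substructure N, (∀ s : Finset X, ↑s ⊆ Y → StrongWithin K.Strong (S s) T) →
        StrongWithin K.Strong (⨆ t : {t : Finset X // (t : Set X) ⊆ Y}, S t) T := by
  induction c using WellFoundedLT.induction with
  | ind c ih =>
  intro Y hY
  rcases Y.finite_or_infinite with hfin | hinf
  · have hU : (⨆ t : {t : Finset X // (t : Set X) ⊆ Y}, S t) = S hfin.toFinset := by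
      refine le_antisymm (iSup_le fun t => ?_)
        (le_iSup (fun t : {t : Finset X // (t : Set X) ⊆ Y} => S t) ⟨hfin.toFinset, by simp⟩)
      exact (hS t.1 hfin.toFinset fun x hx => hfin.mem_toFinset.2 (t.2 hx)).1
    rw [hU]
    exact ⟨fun s hs => hS _ _ fun x hx => hfin.mem_toFinset.2 (hs hx),
      fun T hT => hT _ (by simp)⟩
  have hc : ℵ₀ ≤ c := by rw [← hY]; exact Cardinal.infinite_iff.1 hinf.to_subtype
  obtain ⟨e⟩ : Nonempty (Y ≃ c.ord.ToType) := Cardinal.eq.1 (by rw [hY, mk_ord_toType])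
  have : NoMaxOrder c.ord.ToType := Cardinal.noMaxOrder hc
  have : Nonempty c.ord.ToType := by
    rw [Ordinal.nonempty_toType_iff, Ne, Cardinal.ord_eq_zero]
    exact (aleph0_pos.trans_le hc).ne'
  -- Initial segments of `Y` in an enumeration of order type `c.ord`; each has size below `c`.
  let Z : c.ord.ToType → Set X := fun i => {x | ∃ h : x ∈ Y, e ⟨x, h⟩ < i}
  have hZY : ∀ i, Z i ⊆ Y := fun i x hx => hx.1
  have hZmono : ∀ i j, i ≤ j → Z i ⊆ Z j := fun i j hij x hx => ⟨hx.1, hx.2.trans_le hij⟩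
  have hZcard : ∀ i, #(Z i) < c := fun i => by
    have hi : #(Set.Iio i) < c := by simpa using mk_Iio_lt i (by simp)
    refine lt_of_le_of_lt ?_ hi
    refine Cardinal.mk_le_of_injective (f := fun x : Z i => (⟨e ⟨x, x.2.1⟩, x.2.2⟩ : Set.Iio i)) ?_
    intro x y hxy
    have := e.injective (congrArg Subtype.val hxy)
    exact Subtype.ext (congrArg (fun z : Y => (z : X)) this)
  -- Continuity: a finite subset of a segment at a limit index already lies in an earlier segment.
  have hbound : ∀ s : Finset X, ↑s ⊆ Y → ∀ i, Order.IsSuccLimit i →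
      (∀ x (h : x ∈ Y), x ∈ s → e ⟨x, h⟩ < i) → ∃ j < i, ↑s ⊆ Z j := by
    classical
    intro s
    induction s using Finset.induction_on with
    | empty =>
      intro _ i hi _
      obtain ⟨j, hj⟩ := not_isMin_iff.1 hi.1
      exact ⟨j, hj, by simp⟩
    | insert a s _ ihs =>
      intro hs i hi h
      rw [Finset.coe_insert, Set.insert_subset_iff] at hs
      obtain ⟨j, hj, hsj⟩ := ihs hs.2 i hi fun x hx hxs => h x hx (Finset.mem_insert_of_mem hxs)
      obtain ⟨k, hk, hki⟩ : ∃ k, e ⟨a, hs.1⟩ < k ∧ k < i := by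
        by_contra! hcon
        exact hi.2 _ ⟨h a hs.1 (Finset.mem_insert_self _ _), fun b hb hbi =>
          (hcon b hb).not_gt hbi⟩
      refine ⟨max j k, max_lt hj hki, ?_⟩
      rw [Finset.coe_insert, Set.insert_subset_iff]
      exact ⟨⟨hs.1, hk.trans_le (le_max_right _ _)⟩, hsj.trans (hZmono _ _ (le_max_left _ _))⟩
  have hbound' : ∀ s : Finset X, ↑s ⊆ Y → ∃ j, ↑s ⊆ Z j := by
    classical
    intro s
    induction s using Finset.induction_on with
    | empty => intro _; exact ⟨Classical.arbitrary _, by simp⟩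
    | insert a s _ ihs =>
      intro hs
      rw [Finset.coe_insert, Set.insert_subset_iff] at hs
      obtain ⟨j, hsj⟩ := ihs hs.2
      obtain ⟨k, hk⟩ := exists_gt (e ⟨a, hs.1⟩)
      refine ⟨max j k, ?_⟩
      rw [Finset.coe_insert, Set.insert_subset_iff]
      exact ⟨⟨hs.1, hk.trans_le (le_max_right _ _)⟩, hsj.trans (hZmono _ _ (le_max_left _ _))⟩
  let V : c.ord.ToType → L.Substructure N := fun i => ⨆ t : {t : Finset X // (t : Set X) ⊆ Z i}, S t
  have hle : ∀ {W : Set X} (s : Finset X), ↑s ⊆ W → S s ≤ ⨆ t : {t : Finset X // (t : Set X) ⊆ W}, S t :=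
    fun {W} s hs => le_iSup (fun t : {t : Finset X // (t : Set X) ⊆ W} => S t) ⟨s, hs⟩
  have IH := fun i => ih _ (hZcard i) (Z i) rfl
  have hV : ∀ i j, i ≤ j → StrongWithin K.Strong (V i) (V j) := fun i j hij =>
    (IH i).2 _ fun s hs => (IH j).1 s (hs.trans (hZmono i j hij))
  have hlim : ∀ i, Order.IsSuccLimit i → V i = ⨆ j : Set.Iio i, V j := fun i hi => by
    refine le_antisymm (iSup_le fun ⟨s, hs⟩ => ?_) (iSup_le fun j => (hV _ _ j.2.le).1)
    obtain ⟨j, hj, hsj⟩ := hbound s (hs.trans (hZY i)) i hi fun x hx hxs => (hs hxs).2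
    exact (hle s hsj).trans (le_iSup (fun j : Set.Iio i => V j) ⟨j, hj⟩)
  have hU : (⨆ t : {t : Finset X // (t : Set X) ⊆ Y}, S t) = ⨆ i, V i := by
    refine le_antisymm (iSup_le fun ⟨s, hs⟩ => ?_)
      (iSup_le fun i => iSup_le fun ⟨s, hs⟩ => hle s (hs.trans (hZY i)))
    obtain ⟨j, hsj⟩ := hbound' s hs
    exact (hle s hsj).trans (le_iSup V j)
  rw [hU]
  refine ⟨fun s hs => ?_, fun T hT => ?_⟩
  · obtain ⟨j, hsj⟩ := hbound' s hs
    exact StrongWithin.trans ((IH j).1 s hsj) ((K.chain_union V hV hlim).2 j)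
  · exact K.strongWithin_iSup_of_chain V T hV hlim
      fun i => (IH i).2 T fun s hs => hT s (hs.trans (hZY i))

/-- A monotone choice of upper bounds for finite subsets of `D` gives a cofinal system indexed by
finite sets, to which the preceding induction applies. -/
theorem strongWithin_sSup_of_directedOn {D : Set (L.Substructure N)} (hne : D.Nonempty)
    (hdir : DirectedOn (· ≤ ·) D)
    (hD : ∀ S ∈ D, ∀ T ∈ D, S ≤ T → StrongWithin K.Strong S T) :
    (∀ S ∈ D, StrongWithin K.Strong S (sSup D)) ∧
      ∀ T, (∀ S ∈ D, StrongWithin K.Strong S T) → StrongWithin K.Strong (sSup D) T := by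
  have : Nonempty D := hne.to_subtype
  have : IsDirectedOrder D := ⟨fun a b => by
    obtain ⟨c, hc, h1, h2⟩ := hdir a a.2 b b.2
    exact ⟨⟨c, hc⟩, h1, h2⟩⟩
  obtain ⟨F, hmono, hF⟩ := exists_finset_upperBound_monotone D
  have key := K.strongWithin_iSup_finset_subset (fun s => (F s : L.Substructure N))
    (fun s t hst => hD _ (F s).2 _ (F t).2 (hmono hst)) _ Set.univ rfl
  have hU : (⨆ t : {t : Finset D // (t : Set D) ⊆ Set.univ}, (F t : L.Substructure N)) = sSup D := by
    refine le_antisymm (iSup_le fun t => le_sSup (F t).2) (sSup_le fun S hS => ?_)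
    exact le_trans (hF {⟨S, hS⟩} ⟨S, hS⟩ (Finset.mem_singleton_self _))
      (le_iSup (fun t : {t : Finset D // (t : Set D) ⊆ Set.univ} => (F t : L.Substructure N))
        ⟨{⟨S, hS⟩}, Set.subset_univ _⟩)
  rw [hU] at key
  refine ⟨fun S hS => ?_, fun T hT => key.2 T fun s _ => hT _ (F s).2⟩
  exact StrongWithin.trans (hD S hS _ (F {⟨S, hS⟩}).2
    (hF {⟨S, hS⟩} ⟨S, hS⟩ (Finset.mem_singleton_self _))) (key.1 _ (Set.subset_univ _))

theorem strong_sSup_of_directedOn {D : Set (L.Substructure N)} (hne : D.Nonempty)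
    (hdir : DirectedOn (· ≤ ·) D) (hD : ∀ S ∈ D, K.Strong S) : K.Strong (sSup D) := by
  rw [← strongWithin_top_iff]
  exact (K.strongWithin_sSup_of_directedOn hne hdir
    fun S hS T hT h => K.coherence S T (hD S hS) (hD T hT) h).2 ⊤
    fun S hS => K.strongWithin_top_iff.2 (hD S hS)

end AEC

/-! ### Ultraproducts by `κ`-complete ultrafilters -/

namespace FirstOrder.Language.Ultraproduct

open FirstOrder FirstOrder.Language Filter

variable {L : FirstOrder.Language.{u, u}} {I : Type u} (U : Ultrafilter I) {N : I → Type u}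

/-- The class of `f` in the ultraproduct. -/
def mk (f : ∀ i, N i) : (U : Filter I).Product N := (f : (U : Filter I).Product N)

variable {U}

theorem mk_surjective : Function.Surjective (mk U : (∀ i, N i) → _) := Quot.mk_surjective

theorem mk_eq_mk_iff {f g : ∀ i, N i} : mk U f = mk U g ↔ ∀ᶠ i in U, f i = g i := Quotient.eq''

variable [∀ i, L.Structure (N i)]

theorem funMap_mk {n : ℕ} (F : L.Functions n) (x : Fin n → ∀ i, N i) :
    Structure.funMap F (fun k => mk U (x k)) = mk U fun i => Structure.funMap F fun k => x k i :=
  funMap_cast F x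

theorem relMap_mk {n : ℕ} (R : L.Relations n) (x : Fin n → ∀ i, N i) :
    Structure.RelMap R (fun k => mk U (x k)) ↔ ∀ᶠ i in U, Structure.RelMap R fun k => x k i :=
  relMap_quotient_mk' (s := (U : Filter I).productSetoid N) R x

variable (U) in
/-- The ultraproduct of a family of substructures, as a substructure of the ultraproduct. -/
def internal (T : ∀ i, L.Substructure (N i)) : L.Substructure ((U : Filter I).Product N) where
  carrier := {x | ∃ f : ∀ i, N i, (∀ᶠ i in U, f i ∈ T i) ∧ mk U f = x}
  fun_mem {n} F x hx := by
    choose f hf hfx using hx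
    refine ⟨fun i => Structure.funMap F fun k => f k i, ?_, ?_⟩
    · filter_upwards [eventually_all.2 hf] with i hi
      exact (T i).fun_mem F _ hi
    · rw [← funMap_mk, funext hfx]

variable {T T' : ∀ i, L.Substructure (N i)}

theorem mk_mem_internal {f : ∀ i, N i} : mk U f ∈ internal U T ↔ ∀ᶠ i in U, f i ∈ T i := by
  refine ⟨fun ⟨g, hg, h⟩ => ?_, fun h => ⟨f, h, rfl⟩⟩
  filter_upwards [hg, mk_eq_mk_iff.1 h] with i h1 h2
  exact h2 ▸ h1

theorem internal_le_internal (h : ∀ᶠ i in U, T i ≤ T' i) : internal U T ≤ internal U T' := by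
  rintro _ ⟨f, hf, rfl⟩
  refine ⟨f, ?_, rfl⟩
  filter_upwards [h, hf] with i h1 h2
  exact h1 h2

variable {κ : Cardinal.{u}} [CardinalInterFilter (U : Filter I) κ]

/-- Otherwise fewer than `κ` large sets, one refuting each `x`, would have a large intersection. -/
theorem exists_eventually_of_eventually_exists {X : Type u} (hX : #X < κ) {p : I → X → Prop}
    (h : ∀ᶠ i in U, ∃ x, p i x) : ∃ x, ∀ᶠ i in U, p i x := by
  by_contra hcon
  rw [not_exists] at hcon
  have h1 : ∀ x, ∀ᶠ i in U, ¬ p i x := fun x => Ultrafilter.eventually_not.2 (hcon x)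
  obtain ⟨i, ⟨x, hx⟩, hi⟩ := (h.and ((eventually_cardinal_forall hX).2 h1)).exists
  exact hi x hx

/-- Enumerate the `T i` by one index type `X` of size `c`. A section of the `T i` picks an index at
each coordinate, and completeness makes that index constant on a large set. -/
theorem card_internal_le [∀ i, Nonempty (N i)] {c : Cardinal.{u}} (hc : c < κ)
    (hT : ∀ᶠ i in U, #(T i) ≤ c) : #(internal U T) ≤ c := by
  classical
  induction c using Cardinal.inductionOn with | _ X
  have henum : ∀ i, ∃ e : X → N i, #(T i) ≤ #X → ∀ t ∈ T i, ∃ x, e x = t := by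
    intro i
    by_cases h : #(T i) ≤ #X
    · obtain ⟨j⟩ := h
      refine ⟨Function.extend j Subtype.val fun _ => Classical.arbitrary _, fun _ t ht =>
        ⟨j ⟨t, ht⟩, ?_⟩⟩
      rw [j.injective.extend_apply]
    · exact ⟨fun _ => Classical.arbitrary _, fun h' => absurd h' h⟩
  choose e he using henum
  have : (internal U T : Set _) ⊆ Set.range fun x => mk U fun i => e i x := by
    rintro _ ⟨f, hf, rfl⟩
    obtain ⟨x, hx⟩ := exists_eventually_of_eventually_exists (p := fun i x => e i x = f i) hc
      ((hT.and hf).mono fun i hi => he i hi.1 _ hi.2)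
    exact ⟨x, mk_eq_mk_iff.2 hx⟩
  exact (Cardinal.mk_le_mk_of_subset this).trans Cardinal.mk_range_le

/-- Being an embedding of `W` amounts to fewer than `κ` atomic conditions, each true at almost every
coordinate; completeness makes them hold simultaneously. -/
theorem eventually_exists_embedding (hκ : ℵ₀ < κ) (hL : L.card < κ)
    (W : L.Substructure ((U : Filter I).Product N)) (hW : #W < κ) (r : W → ∀ i, N i)
    (hr : ∀ w, mk U (r w) = w) : ∀ᶠ i in U, ∃ e : W ↪[L] N i, ∀ w, e w = r w i := by
  have := CardinalInterFilter.toCountableInterFilter (U : Filter I) hκ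
  have hpow : ∀ n : ℕ, #(Fin n → W) < κ := fun n => by
    rw [Cardinal.mk_arrow, Cardinal.mk_fin, Cardinal.lift_natCast, Cardinal.lift_uzero]
    rcases lt_or_ge #W ℵ₀ with h | h
    · exact (Cardinal.power_lt_aleph0 h (Cardinal.natCast_lt_aleph0)).trans hκ
    · exact (Cardinal.power_nat_le h).trans_lt hW
  have hF : ∀ n, #(L.Functions n) < κ := fun n => lt_of_le_of_lt
    (Cardinal.mk_le_of_injective (f := fun F : L.Functions n => (Sum.inl ⟨n, F⟩ : L.Symbols))
      fun a b h => by simpa using h) hL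
  have hR : ∀ n, #(L.Relations n) < κ := fun n => lt_of_le_of_lt
    (Cardinal.mk_le_of_injective (f := fun F : L.Relations n => (Sum.inr ⟨n, F⟩ : L.Symbols))
      fun a b h => by simpa using h) hL
  have h1 : ∀ᶠ i in U, ∀ w w' : W, r w i = r w' i → w = w' := by
    rw [eventually_cardinal_forall hW]
    intro w
    rw [eventually_cardinal_forall hW]
    intro w'
    by_cases h : w = w'
    · exact Eventually.of_forall fun _ _ => h
    · have : ¬ ∀ᶠ i in U, r w i = r w' i := by
        rw [← mk_eq_mk_iff, hr, hr]
        exact fun h' => h (Subtype.ext h')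
      exact (Ultrafilter.eventually_not.2 this).mono fun i hi hi' => absurd hi' hi
  have h2 : ∀ᶠ i in U, ∀ (n : ℕ) (F : L.Functions n) (x : Fin n → W),
      r (Structure.funMap F x) i = Structure.funMap F fun k => r (x k) i := by
    rw [eventually_countable_forall]
    intro n
    rw [eventually_cardinal_forall (hF n)]
    intro F
    rw [eventually_cardinal_forall (hpow n)]
    intro x
    rw [← mk_eq_mk_iff, hr, ← funMap_mk]
    simp only [hr]
    rfl
  have h3 : ∀ᶠ i in U, ∀ (n : ℕ) (R : L.Relations n) (x : Fin n → W),
      (Structure.RelMap R fun k => r (x k) i) ↔ Structure.RelMap R x := by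
    rw [eventually_countable_forall]
    intro n
    rw [eventually_cardinal_forall (hR n)]
    intro R
    rw [eventually_cardinal_forall (hpow n)]
    intro x
    have h := relMap_mk (U := U) R fun k => r (x k)
    simp only [hr] at h
    by_cases hx : Structure.RelMap R x
    · exact (h.1 hx).mono fun i hi => iff_of_true hi hx
    · exact (Ultrafilter.eventually_not.2 (mt h.2 hx)).mono fun i hi => iff_of_false hi hx
  filter_upwards [h1, h2, h3] with i h1 h2 h3
  exact ⟨{  toFun := fun w => r w i
            inj' := fun w w' => h1 w w'
            map_fun' := fun F x => h2 _ F x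
            map_rel' := fun R x => h3 _ R x }, fun _ => rfl⟩

theorem eventually_mem_iff_of_internal_le [∀ i, Nonempty (N i)]
    (W : L.Substructure ((U : Filter I).Product N)) (hW : #W < κ) (r : W → ∀ i, N i)
    (hr : ∀ w, mk U (r w) = w) (hTW : internal U T ≤ W) :
    ∀ᶠ i in U, ∀ t, t ∈ T i ↔ ∃ w : W, (w : (U : Filter I).Product N) ∈ internal U T ∧ r w i = t := by
  classical
  have h1 : ∀ᶠ i in U, ∀ w : W, (w : (U : Filter I).Product N) ∈ internal U T → r w i ∈ T i := by
    rw [eventually_cardinal_forall hW]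
    intro w
    by_cases h : (w : (U : Filter I).Product N) ∈ internal U T
    · rw [← hr w, mk_mem_internal] at h
      exact h.mono fun i hi _ => hi
    · exact Eventually.of_forall fun _ h' => absurd h' h
  have h2 : ∀ᶠ i in U, ∀ t ∈ T i, ∃ w : W,
      (w : (U : Filter I).Product N) ∈ internal U T ∧ r w i = t := by
    by_contra hcon
    rw [← Ultrafilter.eventually_not] at hcon
    -- Elements of `T i` missed by the representatives would assemble into a section whose class
    -- lies in `internal U T ≤ W`, yet that class has a representative among the `r w`.
    have hch : ∀ i, ∃ t : N i, (¬ ∀ t ∈ T i, ∃ w : W,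
        (w : (U : Filter I).Product N) ∈ internal U T ∧ r w i = t) → t ∈ T i ∧ ∀ w : W,
        (w : (U : Filter I).Product N) ∈ internal U T → r w i ≠ t := fun i => by
      by_cases h : ∀ t ∈ T i, ∃ w : W, (w : (U : Filter I).Product N) ∈ internal U T ∧ r w i = t
      · exact ⟨Classical.arbitrary _, fun h' => absurd h h'⟩
      · have h' := h
        push Not at h'
        obtain ⟨t, h1, h2⟩ := h'
        exact ⟨t, fun _ => ⟨h1, h2⟩⟩
    choose f hf using hch
    have hmem : mk U f ∈ internal U T := mk_mem_internal.2 (hcon.mono fun i hi => (hf i hi).1)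
    obtain ⟨i, hi, hi'⟩ := (hcon.and (mk_eq_mk_iff.1 (hr ⟨_, hTW hmem⟩))).exists
    exact (hf i hi).2 _ hmem hi'
  filter_upwards [h1, h2] with i h1 h2 t
  exact ⟨h2 t, fun ⟨w, hw, e⟩ => e ▸ h1 w hw⟩

end FirstOrder.Language.Ultraproduct

/-! ### The ultraproduct as a directed union of small internal models -/

namespace AEC

open FirstOrder FirstOrder.Language FirstOrder.Language.Substructure
open FirstOrder.Language.Ultraproduct Filter

variable {L : FirstOrder.Language.{u, u}} (K : AEC L) {I : Type u} {U : Ultrafilter I}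
  {N : I → Type u} [∀ i, L.Structure (N i)]

theorem lsNumber_spec : ℵ₀ ≤ K.lsNumber ∧ L.card ≤ K.lsNumber ∧
    ∀ (N : Type u) [L.Structure N], K.Mod N → ∀ A : Set N,
      ∃ S : L.Substructure N, K.Strong S ∧ A ⊆ S ∧ #S ≤ #A + K.lsNumber := by
  refine csInf_mem (s := {lam : Cardinal.{u} | ℵ₀ ≤ lam ∧ L.card ≤ lam ∧
    ∀ (N : Type u) [L.Structure N], K.Mod N → ∀ A : Set N,
      ∃ S : L.Substructure N, K.Strong S ∧ A ⊆ S ∧ #S ≤ #A + lam}) ?_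
  obtain ⟨lam, h⟩ := K.exists_ls
  refine ⟨max lam (max ℵ₀ L.card), (le_max_left _ _).trans (le_max_right _ _),
    (le_max_right _ _).trans (le_max_right _ _), fun N _ hN A => ?_⟩
  obtain ⟨S, h1, h2, h3⟩ := h hN A
  exact ⟨S, h1, h2, h3.trans (by gcongr; exact le_max_left _ _)⟩

theorem exists_strong_card_le_lsNumber {N : Type u} [L.Structure N] (hN : K.Mod N) (A : Set N)
    (hA : #A ≤ K.lsNumber) : ∃ S : L.Substructure N, K.Strong S ∧ A ⊆ S ∧ #S ≤ K.lsNumber := by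
  obtain ⟨S, h1, h2, h3⟩ := K.lsNumber_spec.2.2 N hN A
  exact ⟨S, h1, h2, h3.trans (Cardinal.add_le_of_le K.lsNumber_spec.1 hA le_rfl)⟩

/-- The ultraproducts of families of strong substructures of Löwenheim–Skolem size. -/
def smallInternal (U : Ultrafilter I) (N : I → Type u) [∀ i, L.Structure (N i)] :
    Set (L.Substructure ((U : Filter I).Product N)) :=
  {W | ∃ T : ∀ i, L.Substructure (N i),
    (∀ᶠ i in U, K.Strong (T i) ∧ #(T i) ≤ K.lsNumber) ∧ W = internal U T}

variable {K} {κ : Cardinal.{u}} [CardinalInterFilter (U : Filter I) κ]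

/-- A Łoś-type transfer: at one suitable coordinate a single embedding of the larger model carries
the pair `W ≤ W'` onto `T i ≤ T' i`, where coherence in `N i` applies. -/
theorem strongWithin_of_mem_smallInternal [∀ i, Nonempty (N i)] (hκ : K.lsNumber < κ)
    {W W' : L.Substructure ((U : Filter I).Product N)} (hW : W ∈ K.smallInternal U N)
    (hW' : W' ∈ K.smallInternal U N) (hle : W ≤ W') : StrongWithin K.Strong W W' := by
  obtain ⟨T, hT, rfl⟩ := hW
  obtain ⟨T', hT', rfl⟩ := hW'
  have hcard : #(internal U T') < κ :=
    (card_internal_le hκ (hT'.mono fun _ h => h.2)).trans_lt hκ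
  choose r hr using fun w : internal U T' => mk_surjective (U := U) (w : (U : Filter I).Product N)
  obtain ⟨i, ⟨e, he⟩, h1, h2, h3, h4⟩ := ((eventually_exists_embedding
    (K.lsNumber_spec.1.trans_lt hκ) (K.lsNumber_spec.2.1.trans_lt hκ) _ hcard r hr).and
    ((eventually_mem_iff_of_internal_le _ hcard r hr hle).and
      ((eventually_mem_iff_of_internal_le _ hcard r hr le_rfl).and (hT.and hT')))).exists
  have e1 : T i = ((internal U T).comap (internal U T').subtype.toHom).map e.toHom := by
    ext t
    rw [h1, Substructure.mem_map]
    exact exists_congr fun w => and_congr Iff.rfl (by rw [← he]; rfl)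
  have e2 : T' i = ((internal U T').comap (internal U T').subtype.toHom).map e.toHom := by
    ext t
    rw [h2, Substructure.mem_map]
    exact exists_congr fun w => and_congr Iff.rfl (by rw [← he]; rfl)
  have h5 : T i ≤ T' i := by
    rw [e1, e2]
    exact monotone_map (monotone_comap hle)
  have h6 := K.coherence _ _ h3.1 h4.1 h5
  rw [e1, e2, strongWithin_map_iff, strongWithin_comap_subtype_iff hle le_rfl] at h6
  exact h6

theorem directedOn_smallInternal (hN : ∀ i, K.Mod (N i)) :
    DirectedOn (· ≤ ·) (K.smallInternal U N) := by
  rintro _ ⟨T, hT, rfl⟩ _ ⟨T', hT', rfl⟩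
  have : ∀ i, ∃ S : L.Substructure (N i), (#(T i) ≤ K.lsNumber → #(T' i) ≤ K.lsNumber →
      T i ≤ S ∧ T' i ≤ S ∧ K.Strong S ∧ #S ≤ K.lsNumber) := fun i => by
    by_cases h : #(T i) ≤ K.lsNumber ∧ #(T' i) ≤ K.lsNumber
    · obtain ⟨S, h1, h2, h3⟩ := K.exists_strong_card_le_lsNumber (hN i) (T i ∪ T' i : Set (N i))
        ((Cardinal.mk_union_le _ _).trans (Cardinal.add_le_of_le K.lsNumber_spec.1 h.1 h.2))
      exact ⟨S, fun _ _ => ⟨Set.subset_union_left.trans h2, Set.subset_union_right.trans h2,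
        h1, h3⟩⟩
    · exact ⟨⊤, fun h1 h2 => absurd ⟨h1, h2⟩ h⟩
  choose S hS using this
  have key : ∀ᶠ i in U, T i ≤ S i ∧ T' i ≤ S i ∧ K.Strong (S i) ∧ #(S i) ≤ K.lsNumber := by
    filter_upwards [hT, hT'] with i h1 h2
    exact hS i h1.2 h2.2
  exact ⟨_, ⟨S, key.mono fun _ h => h.2.2, rfl⟩, internal_le_internal (key.mono fun _ h => h.1),
    internal_le_internal (key.mono fun _ h => h.2.1)⟩

theorem exists_mem_smallInternal (hN : ∀ i, K.Mod (N i)) (x : (U : Filter I).Product N) :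
    ∃ W ∈ K.smallInternal U N, x ∈ W := by
  obtain ⟨f, rfl⟩ := mk_surjective x
  choose T h1 h2 h3 using fun i => K.exists_strong_card_le_lsNumber (hN i) {f i}
    (by rw [Cardinal.mk_singleton]; exact Cardinal.one_le_aleph0.trans K.lsNumber_spec.1)
  exact ⟨_, ⟨T, Eventually.of_forall fun i => ⟨h1 i, h3 i⟩, rfl⟩,
    mk_mem_internal.2 (Eventually.of_forall fun i => h2 i rfl)⟩

/-- The small internal models cover the ultraproduct, so being strong in their directed union is
being strong in the ultraproduct; in particular the latter is in `K`. -/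
theorem strong_of_mem_smallInternal [∀ i, Nonempty (N i)] (hκ : K.lsNumber < κ) (hN : ∀ i, K.Mod (N i))
    {W : L.Substructure ((U : Filter I).Product N)} (hW : W ∈ K.smallInternal U N) :
    K.Strong W := by
  have htop : sSup (K.smallInternal U N) = ⊤ := by
    refine top_le_iff.1 fun x _ => ?_
    obtain ⟨W, hW, hx⟩ := exists_mem_smallInternal hN x
    exact le_sSup hW hx
  have := (K.strongWithin_sSup_of_directedOn ⟨W, hW⟩ (directedOn_smallInternal hN)
    fun S hS T hT h => strongWithin_of_mem_smallInternal hκ hS hT h).1 W hW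
  rw [htop] at this
  exact K.strongWithin_top_iff.1 this

end AEC

-- The hypothesis on `I` says exactly that fewer than `κ` tails share a tail, so `atTop` is
-- `κ`-complete.
open Filter in
theorem IsStronglyCompact.exists_ultrafilter_le_atTop {κ : Cardinal.{u}}
    (hκ : IsStronglyCompact κ) {I : Type u} [Preorder I]
    (hI : ∀ s : Set I, #s < κ → BddAbove s) :
    ∃ U : Ultrafilter I, (U : Filter I) ≤ atTop ∧ CardinalInterFilter (U : Filter I) κ := by
  have : Nonempty I := (hI ∅ (by simpa using aleph0_pos.trans hκ.aleph0_lt)).nonempty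
  have : IsDirectedOrder I := ⟨fun a b => by
    obtain ⟨c, hc⟩ := hI {a, b} ((Set.toFinite _).lt_aleph0.trans hκ.aleph0_lt)
    exact ⟨c, hc (by simp), hc (by simp)⟩⟩
  refine hκ.exists_ultrafilter I atTop inferInstance ⟨fun S hS h => ?_⟩
  choose! b hb using fun s hs => mem_atTop_sets.1 (h s hs)
  obtain ⟨c, hc⟩ := hI (b '' S) (mk_image_le.trans_lt hS)
  exact mem_atTop_sets.2 ⟨c, fun d hd s hs => hb s hs d ((hc (Set.mem_image_of_mem b hs)).trans hd)⟩

/-! ### Embedding large models into the ultraproduct -/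

namespace AEC

open FirstOrder FirstOrder.Language FirstOrder.Language.Substructure
open FirstOrder.Language.Ultraproduct Filter

variable {L : FirstOrder.Language.{u, u}} {K : AEC L}

theorem exists_isKEmbedding_ultraproduct {κ : Cardinal.{u}} {I : Type u} [Preorder I]
    {U : Ultrafilter I} [CardinalInterFilter (U : Filter I) κ] (hU : (U : Filter I) ≤ atTop)
    (hκ : K.lsNumber < κ) {N : I → Type u} [∀ i, L.Structure (N i)] [∀ i, Nonempty (N i)]
    (hN : ∀ i, K.Mod (N i)) {M : Type u} [L.Structure M] (hM : K.Mod M)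
    (A : I → L.Substructure M) (hA : Monotone A) (hAM : ∀ i, K.Strong (A i))
    (hcof : ∀ B : Set M, #B ≤ K.lsNumber → ∃ i, B ⊆ A i)
    (g : ∀ i, A i ↪[L] N i) (hg : ∀ i, K.IsKEmbedding (g i)) :
    ∃ (G : M ↪[L] (U : Filter I).Product N) (r : M → ∀ i, N i), K.IsKEmbedding G ∧
      (∀ m, G m = Ultraproduct.mk U (r m)) ∧
      ∀ m, ∀ᶠ i in U, ∃ h : m ∈ A i, r m i = g i ⟨m, h⟩ := by
  classical
  have hev : ∀ B : Set M, #B ≤ K.lsNumber → ∀ᶠ i in U, B ⊆ A i := fun B hB => by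
    obtain ⟨i, hi⟩ := hcof B hB
    exact ((eventually_ge_atTop i).filter_mono hU).mono fun j hj => hi.trans (hA hj)
  -- The default value is harmless: each `m` lies in `A i` for almost all `i`.
  let r : M → ∀ i, N i := fun m i => if h : m ∈ A i then g i ⟨m, h⟩ else Classical.arbitrary _
  have hr' : ∀ m i (h : m ∈ A i), r m i = g i ⟨m, h⟩ := fun m i h => dif_pos h
  have hmem : ∀ m, ∀ᶠ i in U, m ∈ A i := fun m =>
    (hev {m} (by rw [mk_singleton]; exact one_le_aleph0.trans K.lsNumber_spec.1)).mono
      fun i hi => hi rfl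
  have hr : ∀ m, ∀ᶠ i in U, ∃ h : m ∈ A i, r m i = g i ⟨m, h⟩ := fun m =>
    (hmem m).mono fun i hi => ⟨hi, hr' m i hi⟩
  let G : M ↪[L] (U : Filter I).Product N :=
    { toFun := fun m => Ultraproduct.mk U (r m)
      inj' := fun m m' h => by
        obtain ⟨i, h1, h2, h3⟩ := ((mk_eq_mk_iff.1 h).and ((hmem m).and (hmem m'))).exists
        rw [hr' m i h2, hr' m' i h3] at h1
        exact congrArg Subtype.val ((g i).injective h1)
      map_fun' := fun {n} F x => by
        refine Eq.trans ?_ (funMap_mk F fun k => r (x k)).symm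
        refine mk_eq_mk_iff.2 ((eventually_all.2 fun k => hmem (x k)).mono fun i hi => ?_)
        have h1 : (fun k => r (x k) i) = fun k => g i ⟨x k, hi k⟩ :=
          funext fun k => hr' _ _ (hi k)
        rw [h1, hr' _ i ((A i).fun_mem F x hi)]
        exact (g i).map_fun F fun k => ⟨x k, hi k⟩
      map_rel' := fun {n} R x => by
        have key : ∀ᶠ i in U, ((Structure.RelMap R fun k => r (x k) i) ↔ Structure.RelMap R x) := by
          refine (eventually_all.2 fun k => hmem (x k)).mono fun i hi => ?_
          have h1 : (fun k => r (x k) i) = fun k => g i ⟨x k, hi k⟩ :=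
            funext fun k => hr' _ _ (hi k)
          rw [h1]
          exact (g i).map_rel R fun k => ⟨x k, hi k⟩
        refine (relMap_mk R fun k => r (x k)).trans ((eventually_congr key).trans ?_)
        exact eventually_const }
  refine ⟨G, r, ?_, fun _ => rfl, hr⟩
  let D : Set (L.Substructure M) := {B | K.Strong B ∧ #B ≤ K.lsNumber}
  have hDU : ∀ m, ∃ B ∈ D, m ∈ B := fun m => by
    obtain ⟨B, h1, h2, h3⟩ := K.exists_strong_card_le_lsNumber hM {m}
      (by rw [mk_singleton]; exact one_le_aleph0.trans K.lsNumber_spec.1)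
    exact ⟨B, ⟨h1, h3⟩, h2 rfl⟩
  have hDdir : DirectedOn (· ≤ ·) D := fun B hB B' hB' => by
    obtain ⟨C, h1, h2, h3⟩ := K.exists_strong_card_le_lsNumber hM (B ∪ B' : Set M)
      ((mk_union_le _ _).trans (add_le_of_le K.lsNumber_spec.1 hB.2 hB'.2))
    exact ⟨C, ⟨h1, h3⟩, Set.subset_union_left.trans h2, Set.subset_union_right.trans h2⟩
  have hstrong : ∀ B ∈ D, K.Strong (B.map G.toHom) := fun B hB => by
    -- The image of `B` is the ultraproduct of the images of `B ∩ A i`. A section of these names an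
    -- element of `B` at almost every coordinate, and `#B < κ` makes the element constant on a large
    -- set.
    let T : ∀ i, L.Substructure (N i) := fun i =>
      ((B.comap (A i).subtype.toHom).map (g i).toHom)
    have hBA := hev B hB.2
    refine strong_of_mem_smallInternal hκ hN ⟨T, ?_, ?_⟩
    · refine hBA.mono fun i hi => ⟨K.strong_map (hg i) (K.coherence _ _ hB.1 (hAM i) hi).2, ?_⟩
      refine le_trans (mk_image_le (f := g i)) (le_trans ?_ hB.2)
      exact mk_le_of_injective (f := fun x => (⟨x.1.1, x.2⟩ : B)) fun x y h =>
        Subtype.ext (Subtype.ext (congrArg (fun z : B => (z : M)) h))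
    · ext x
      obtain ⟨f, rfl⟩ := mk_surjective x
      rw [mk_mem_internal, Substructure.mem_map]
      constructor
      · rintro ⟨b, hb, h⟩
        filter_upwards [mk_eq_mk_iff.1 h, hmem b] with i h1 h2
        exact ⟨⟨b, h2⟩, hb, (hr' b i h2).symm.trans h1⟩
      · intro h
        obtain ⟨b, hb⟩ := exists_eventually_of_eventually_exists (X := B)
          (p := fun i b => r b i = f i) (hB.2.trans_lt hκ) (h.mono fun i ⟨a, ha, e⟩ =>
            ⟨⟨a, ha⟩, (hr' a i a.2).trans e⟩)
        exact ⟨b, b.2, mk_eq_mk_iff.2 hb⟩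
  have hrange : G.toHom.range = sSup ((fun B => B.map G.toHom) '' D) := by
    refine le_antisymm ?_ (sSup_le ?_)
    · rintro _ ⟨m, rfl⟩
      obtain ⟨B, hB, hm⟩ := hDU m
      exact (le_sSup (Set.mem_image_of_mem (fun B => B.map G.toHom) hB) :
        B.map G.toHom ≤ _) (mem_map_of_mem _ hm)
    · rintro _ ⟨B, -, rfl⟩
      exact Hom.map_le_range
  rw [IsKEmbedding, hrange]
  obtain ⟨B, hB, -, hB'⟩ := K.exists_strong_card_le_lsNumber hM ∅ (by simp)
  refine K.strong_sSup_of_directedOn (Set.Nonempty.image _ ⟨B, hB, hB'⟩) ?_ ?_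
  · rintro _ ⟨B, hB, rfl⟩ _ ⟨B', hB', rfl⟩
    obtain ⟨C, hC, h1, h2⟩ := hDdir B hB B' hB'
    exact ⟨_, Set.mem_image_of_mem _ hC, monotone_map h1, monotone_map h2⟩
  · rintro _ ⟨B, hB, rfl⟩
    exact hstrong B hB

/-- Joint `K`-embeddings of the members of two directed systems of strong substructures of `M₁` and
`M₂` yield a joint `K`-embedding of `M₁` and `M₂`. The relation `E` bounds the identifications from
above, and the relations `F i` force identifications. -/
theorem exists_joint_isKEmbedding {κ : Cardinal.{u}} (hκ : IsStronglyCompact κ)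
    (hLS : K.lsNumber < κ) {I : Type u} [Preorder I] (hI : ∀ s : Set I, #s < κ → BddAbove s)
    {M₁ M₂ : Type u} [L.Structure M₁] [L.Structure M₂] (hM₁ : K.Mod M₁) (hM₂ : K.Mod M₂)
    {A₁ : I → L.Substructure M₁} {A₂ : I → L.Substructure M₂} (hA₁ : Monotone A₁)
    (hA₂ : Monotone A₂) (hs₁ : ∀ i, K.Strong (A₁ i)) (hs₂ : ∀ i, K.Strong (A₂ i))
    (hcof₁ : ∀ B : Set M₁, #B ≤ K.lsNumber → ∃ i, B ⊆ A₁ i)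
    (hcof₂ : ∀ B : Set M₂, #B ≤ K.lsNumber → ∃ i, B ⊆ A₂ i)
    (hne : ∀ i, Nonempty (A₁ i) ∨ Nonempty (A₂ i)) {E : M₁ → M₂ → Prop} {F : I → M₁ → M₂ → Prop}
    (h : ∀ i, ∃ (N : Type u) (_ : L.Structure N) (g₁ : A₁ i ↪[L] N) (g₂ : A₂ i ↪[L] N),
      K.IsKEmbedding g₁ ∧ K.IsKEmbedding g₂ ∧ (∀ a b, g₁ a = g₂ b → E a b) ∧
      ∀ (a : A₁ i) (b : A₂ i), F i a b → g₁ a = g₂ b) :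
    ∃ (N : Type u) (_ : L.Structure N) (g₁ : M₁ ↪[L] N) (g₂ : M₂ ↪[L] N),
      K.IsKEmbedding g₁ ∧ K.IsKEmbedding g₂ ∧ (∀ a b, g₁ a = g₂ b → E a b) ∧
      ∀ a b, (∃ j, ∀ i, j ≤ i → F i a b) → g₁ a = g₂ b := by
  choose N _ g₁ g₂ hg₁ hg₂ hE hF using h
  have : ∀ i, Nonempty (N i) := fun i => (hne i).elim (fun h => h.map (g₁ i)) fun h => h.map (g₂ i)
  obtain ⟨U, hU, _⟩ := hκ.exists_ultrafilter_le_atTop hI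
  have hN : ∀ i, K.Mod (N i) := fun i => (K.mod_of_strong _ (hg₁ i)).2
  obtain ⟨G₁, r₁, hG₁, hr₁, hgr₁⟩ :=
    exists_isKEmbedding_ultraproduct hU hLS hN hM₁ A₁ hA₁ hs₁ hcof₁ g₁ hg₁
  obtain ⟨G₂, r₂, hG₂, hr₂, hgr₂⟩ :=
    exists_isKEmbedding_ultraproduct hU hLS hN hM₂ A₂ hA₂ hs₂ hcof₂ g₂ hg₂
  refine ⟨_, _, G₁, G₂, hG₁, hG₂, fun a b hab => ?_, fun a b ⟨j, hj⟩ => ?_⟩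
  · rw [hr₁, hr₂, mk_eq_mk_iff] at hab
    obtain ⟨i, h, ⟨h₁, h₁'⟩, h₂, h₂'⟩ := (hab.and ((hgr₁ a).and (hgr₂ b))).exists
    exact hE i ⟨a, h₁⟩ ⟨b, h₂⟩ (by rw [← h₁', ← h₂', h])
  · rw [hr₁, hr₂, mk_eq_mk_iff]
    filter_upwards [hgr₁ a, hgr₂ b, hU (eventually_ge_atTop j)] with i ⟨h₁, h₁'⟩ ⟨h₂, h₂'⟩ hi
    rw [h₁', h₂']
    exact hF i ⟨a, h₁⟩ ⟨b, h₂⟩ (hj i hi)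

/-! ### The directed systems of strong submodels of size below `κ` -/

variable (K) in
/-- Strong substructures of cardinality in `[μ, κ)`, nonempty if possible. -/
def IsStrongCard (μ κ : Cardinal.{u}) {M : Type u} [L.Structure M] (A : L.Substructure M) : Prop :=
  K.Strong A ∧ #A ∈ Set.Ico μ κ ∧ (Nonempty M → Nonempty A)

theorem exists_isStrongCard {μ κ : Cardinal.{u}} (hκ : ℵ₀ < κ) (hLS : K.lsNumber < κ)
    (hμ : μ < κ) {M : Type u} [L.Structure M] (hM : K.Mod M) (hμM : μ ≤ #M) (X : Set M)
    (hX : #X < κ) : ∃ A : L.Substructure M, K.IsStrongCard μ κ A ∧ X ⊆ A := by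
  -- `Y` forces size at least `μ`; `Z` below supplies a point when there is one.
  obtain ⟨Y, hY⟩ := le_mk_iff_exists_set.1 hμM
  obtain ⟨Z, hZ, hZM⟩ : ∃ Z : Set M, #Z < κ ∧ (Nonempty M → Z.Nonempty) := by
    rcases isEmpty_or_nonempty M with h | ⟨⟨m⟩⟩
    · exact ⟨∅, by simpa using aleph0_pos.trans hκ, fun h' => (not_isEmpty_iff.2 h' h).elim⟩
    · exact ⟨{m}, by simpa using one_lt_aleph0.trans hκ, fun _ => ⟨m, rfl⟩⟩
  obtain ⟨A, h1, h2, h3⟩ := K.lsNumber_spec.2.2 M hM (X ∪ (Y ∪ Z))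
  have hXA : X ⊆ A := Set.subset_union_left.trans h2
  have hYA : Y ⊆ A := (Set.subset_union_left.trans Set.subset_union_right).trans h2
  have hZA : Z ⊆ A := (Set.subset_union_right.trans Set.subset_union_right).trans h2
  refine ⟨A, ⟨h1, ⟨hY ▸ mk_le_mk_of_subset hYA, h3.trans_lt ?_⟩, fun h =>
    (hZM h).elim fun z hz => ⟨z, hZA hz⟩⟩, hXA⟩
  refine add_lt_of_lt hκ.le ((mk_union_le _ _).trans_lt (add_lt_of_lt hκ.le hX ?_)) hLS
  exact (mk_union_le _ _).trans_lt (add_lt_of_lt hκ.le (hY ▸ hμ) hZ)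

theorem card_iUnion_coe_lt {κ : Cardinal.{u}} (hκ : κ.IsRegular) {I : Type u} {s : Set I} (hs : #s < κ)
    {M : Type u} [L.Structure M] {A : I → L.Substructure M} (hA : ∀ i, #(A i) < κ) :
    #(⋃ i : s, (A i : Set M) : Set M) < κ :=
  (card_iUnion_lt_iff_forall_of_isRegular hκ hs).2 fun i => hA i

theorem joint_embedding_of_isStrongCard {κ μ : Cardinal.{u}} (hκ : IsStronglyCompact κ)
    (hLS : K.lsNumber < κ) (hμ : μ < κ) {M₁ M₂ : Type u} [L.Structure M₁] [L.Structure M₂]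
    (hM₁ : K.Mod M₁) (hM₂ : K.Mod M₂) (hμ₁ : μ ≤ #M₁) (hμ₂ : μ ≤ #M₂)
    (hne : Nonempty M₁ ∨ Nonempty M₂) {E : M₁ → M₂ → Prop}
    (h : ∀ (A₁ : L.Substructure M₁) (A₂ : L.Substructure M₂), K.IsStrongCard μ κ A₁ →
      K.IsStrongCard μ κ A₂ →
      ∃ (N : Type u) (_ : L.Structure N) (g₁ : A₁ ↪[L] N) (g₂ : A₂ ↪[L] N),
        K.IsKEmbedding g₁ ∧ K.IsKEmbedding g₂ ∧ ∀ a b, g₁ a = g₂ b → E a b) :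
    ∃ (N : Type u) (_ : L.Structure N) (g₁ : M₁ ↪[L] N) (g₂ : M₂ ↪[L] N),
      K.IsKEmbedding g₁ ∧ K.IsKEmbedding g₂ ∧ ∀ a b, g₁ a = g₂ b → E a b := by
  let I := {p : L.Substructure M₁ × L.Substructure M₂ //
    K.IsStrongCard μ κ p.1 ∧ K.IsStrongCard μ κ p.2}
  have hX : ∀ (X₁ : Set M₁) (X₂ : Set M₂), #X₁ < κ → #X₂ < κ →
      ∃ i : I, X₁ ⊆ i.1.1 ∧ X₂ ⊆ i.1.2 := fun X₁ X₂ h₁ h₂ => by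
    obtain ⟨B₁, hB₁, hX₁⟩ := exists_isStrongCard hκ.aleph0_lt hLS hμ hM₁ hμ₁ X₁ h₁
    obtain ⟨B₂, hB₂, hX₂⟩ := exists_isStrongCard hκ.aleph0_lt hLS hμ hM₂ hμ₂ X₂ h₂
    exact ⟨⟨(B₁, B₂), hB₁, hB₂⟩, hX₁, hX₂⟩
  have h0 : (0 : Cardinal.{u}) < κ := aleph0_pos.trans hκ.aleph0_lt
  have hI : ∀ s : Set I, #s < κ → BddAbove s := fun s hs => by
    obtain ⟨i, h₁, h₂⟩ := hX _ _
      (card_iUnion_coe_lt hκ.isRegular hs (A := fun i : I => i.1.1) fun i => i.2.1.2.1.2)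
      (card_iUnion_coe_lt hκ.isRegular hs (A := fun i : I => i.1.2) fun i => i.2.2.2.1.2)
    exact ⟨i, fun j hj => ⟨(Set.subset_iUnion (fun i : s => (i.1.1.1 : Set M₁)) ⟨j, hj⟩).trans h₁,
      (Set.subset_iUnion (fun i : s => (i.1.1.2 : Set M₂)) ⟨j, hj⟩).trans h₂⟩⟩
  obtain ⟨N, _, g₁, g₂, hg₁, hg₂, hE, -⟩ := exists_joint_isKEmbedding hκ hLS hI hM₁ hM₂
    (A₁ := fun i => i.1.1) (A₂ := fun i => i.1.2) (fun _ _ hij => hij.1) (fun _ _ hij => hij.2)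
    (fun i => i.2.1.1) (fun i => i.2.2.1)
    (fun B hB => (hX B ∅ (hB.trans_lt hLS) (by simpa using h0)).imp fun _ h => h.1)
    (fun B hB => (hX ∅ B (by simpa using h0) (hB.trans_lt hLS)).imp fun _ h => h.2)
    (fun i => hne.imp i.2.1.2.2 i.2.2.2.2) (E := E) (F := fun _ _ _ => False) fun i => by
      obtain ⟨N, hN, g₁, g₂, h₁, h₂, h₃⟩ := h _ _ i.2.1 i.2.2
      exact ⟨N, hN, g₁, g₂, h₁, h₂, h₃, fun _ _ => False.elim⟩
  exact ⟨N, _, g₁, g₂, hg₁, hg₂, hE⟩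

/-- The base is approximated together with the two sides. Each `m : M₀` lies in the base of a whole
tail of triples, which forces `f₁ m` and `f₂ m` to be identified. -/
theorem amalgamation_of_isStrongCard {κ μ : Cardinal.{u}} (hκ : IsStronglyCompact κ)
    (hLS : K.lsNumber < κ) (hμ : μ < κ) {M₀ M₁ M₂ : Type u} [L.Structure M₀] [L.Structure M₁]
    [L.Structure M₂] (hM₀ : K.Mod M₀) (hM₁ : K.Mod M₁) (hM₂ : K.Mod M₂) (hμ₀ : μ ≤ #M₀)
    (hμ₁ : μ ≤ #M₁) (hμ₂ : μ ≤ #M₂) (hne : Nonempty M₁ ∨ Nonempty M₂) {E : M₁ → M₂ → Prop}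
    (f₁ : M₀ ↪[L] M₁) (f₂ : M₀ ↪[L] M₂)
    (h : ∀ (A₀ : L.Substructure M₀) (A₁ : L.Substructure M₁) (A₂ : L.Substructure M₂),
      K.IsStrongCard μ κ A₀ → K.IsStrongCard μ κ A₁ → K.IsStrongCard μ κ A₂ →
      ∀ (h₁ : ∀ a : A₀, f₁ a ∈ A₁) (h₂ : ∀ a : A₀, f₂ a ∈ A₂),
      ∃ (N : Type u) (_ : L.Structure N) (g₁ : A₁ ↪[L] N) (g₂ : A₂ ↪[L] N),
        K.IsKEmbedding g₁ ∧ K.IsKEmbedding g₂ ∧ (∀ a b, g₁ a = g₂ b → E a b) ∧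
        ∀ a : A₀, g₁ ⟨f₁ a, h₁ a⟩ = g₂ ⟨f₂ a, h₂ a⟩) :
    ∃ (N : Type u) (_ : L.Structure N) (g₁ : M₁ ↪[L] N) (g₂ : M₂ ↪[L] N),
      K.IsKEmbedding g₁ ∧ K.IsKEmbedding g₂ ∧ (∀ a b, g₁ a = g₂ b → E a b) ∧
      g₁.comp f₁ = g₂.comp f₂ := by
  let I := {p : L.Substructure M₀ × L.Substructure M₁ × L.Substructure M₂ //
    K.IsStrongCard μ κ p.1 ∧ K.IsStrongCard μ κ p.2.1 ∧ K.IsStrongCard μ κ p.2.2 ∧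
    (∀ a : p.1, f₁ a ∈ p.2.1) ∧ ∀ a : p.1, f₂ a ∈ p.2.2}
  have hX : ∀ (X₀ : Set M₀) (X₁ : Set M₁) (X₂ : Set M₂), #X₀ < κ → #X₁ < κ → #X₂ < κ →
      ∃ i : I, X₀ ⊆ i.1.1 ∧ X₁ ⊆ i.1.2.1 ∧ X₂ ⊆ i.1.2.2 := fun X₀ X₁ X₂ h₀ h₁ h₂ => by
    have hω := hκ.aleph0_lt
    obtain ⟨B₀, hB₀, hX₀⟩ := exists_isStrongCard hω hLS hμ hM₀ hμ₀ X₀ h₀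
    have hB₀' : #(B₀ : Set M₀) < κ := hB₀.2.1.2
    -- `B₀` is chosen first, so that its images, of size below `κ`, can be absorbed into `B₁` and
    -- `B₂`.
    obtain ⟨B₁, hB₁, hX₁⟩ := exists_isStrongCard hω hLS hμ hM₁ hμ₁ (X₁ ∪ f₁ '' B₀)
      ((mk_union_le _ _).trans_lt (add_lt_of_lt hω.le h₁ (mk_image_le.trans_lt hB₀')))
    obtain ⟨B₂, hB₂, hX₂⟩ := exists_isStrongCard hω hLS hμ hM₂ hμ₂ (X₂ ∪ f₂ '' B₀)
      ((mk_union_le _ _).trans_lt (add_lt_of_lt hω.le h₂ (mk_image_le.trans_lt hB₀')))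
    exact ⟨⟨(B₀, B₁, B₂), hB₀, hB₁, hB₂, fun a => hX₁ (Or.inr ⟨a, a.2, rfl⟩),
      fun a => hX₂ (Or.inr ⟨a, a.2, rfl⟩)⟩, hX₀, Set.subset_union_left.trans hX₁,
      Set.subset_union_left.trans hX₂⟩
  have h0 : (0 : Cardinal.{u}) < κ := aleph0_pos.trans hκ.aleph0_lt
  have hI : ∀ s : Set I, #s < κ → BddAbove s := fun s hs => by
    obtain ⟨i, h₀, h₁, h₂⟩ := hX _ _ _
      (card_iUnion_coe_lt hκ.isRegular hs (A := fun i : I => i.1.1) fun i => i.2.1.2.1.2)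
      (card_iUnion_coe_lt hκ.isRegular hs (A := fun i : I => i.1.2.1) fun i => i.2.2.1.2.1.2)
      (card_iUnion_coe_lt hκ.isRegular hs (A := fun i : I => i.1.2.2) fun i => i.2.2.2.1.2.1.2)
    exact ⟨i, fun j hj => ⟨(Set.subset_iUnion (fun i : s => (i.1.1.1 : Set M₀)) ⟨j, hj⟩).trans h₀,
      (Set.subset_iUnion (fun i : s => (i.1.1.2.1 : Set M₁)) ⟨j, hj⟩).trans h₁,
      (Set.subset_iUnion (fun i : s => (i.1.1.2.2 : Set M₂)) ⟨j, hj⟩).trans h₂⟩⟩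
  obtain ⟨N, _, g₁, g₂, hg₁, hg₂, hE, hF⟩ := exists_joint_isKEmbedding hκ hLS hI hM₁ hM₂
    (A₁ := fun i => i.1.2.1) (A₂ := fun i => i.1.2.2) (fun _ _ hij => hij.2.1)
    (fun _ _ hij => hij.2.2) (fun i => i.2.2.1.1) (fun i => i.2.2.2.1.1)
    (fun B hB => (hX ∅ B ∅ (by simpa using h0) (hB.trans_lt hLS) (by simpa using h0)).imp
      fun _ h => h.2.1)
    (fun B hB => (hX ∅ ∅ B (by simpa using h0) (by simpa using h0) (hB.trans_lt hLS)).imp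
      fun _ h => h.2.2)
    (fun i => hne.imp i.2.2.1.2.2 i.2.2.2.1.2.2) (E := E)
    (F := fun i a b => ∃ m ∈ i.1.1, f₁ m = a ∧ f₂ m = b) fun i => by
      obtain ⟨N, hN, g₁, g₂, h₁, h₂, h₃, h₄⟩ :=
        h _ _ _ i.2.1 i.2.2.1 i.2.2.2.1 i.2.2.2.2.1 i.2.2.2.2.2
      refine ⟨N, hN, g₁, g₂, h₁, h₂, h₃, ?_⟩
      rintro ⟨_, ha⟩ ⟨_, hb⟩ ⟨m, hm, rfl, rfl⟩
      exact h₄ ⟨m, hm⟩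
  refine ⟨N, _, g₁, g₂, hg₁, hg₂, hE, ?_⟩
  ext m
  obtain ⟨j, hj, -⟩ := hX {m} ∅ ∅ (by simpa using one_lt_aleph0.trans hκ.aleph0_lt)
    (by simpa using h0) (by simpa using h0)
  exact hF _ _ ⟨j, fun i hij => ⟨m, hij.1 (hj rfl), rfl, rfl⟩⟩

theorem isKEmbedding_codRestrict {M N : Type u} [L.Structure M] [L.Structure N] {f : M ↪[L] N}
    (hf : K.IsKEmbedding f) {A : L.Substructure M} {B : L.Substructure N} (hA : K.Strong A)
    (hB : K.Strong B) (h : ∀ a : A, f a ∈ B) :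
    K.IsKEmbedding ((f.comp A.subtype).codRestrict B h) := by
  refine IsKEmbedding.of_comp (K.strong_iff_isKEmbedding_subtype.1 hB) ?_
  exact hf.comp (K.strong_iff_isKEmbedding_subtype.1 hA)

/-- Embeddings reflect, and by the next lemma preserve, values of closed terms; so near disjointness
can be expressed inside `M₁`, independently of the amalgam. -/
theorem mem_closure_empty_of_apply {M N : Type u} [L.Structure M] [L.Structure N] (f : M ↪[L] N)
    {m : M} (h : f m ∈ Substructure.closure L (∅ : Set N)) :
    m ∈ Substructure.closure L (∅ : Set M) := by
  rw [← Set.image_empty f, ← Embedding.coe_toHom, Substructure.closure_image] at h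
  obtain ⟨m', hm', e⟩ := h
  exact f.injective e ▸ hm'

theorem apply_mem_closure_empty {M N : Type u} [L.Structure M] [L.Structure N] (f : M ↪[L] N)
    {m : M} (h : m ∈ Substructure.closure L (∅ : Set M)) :
    f m ∈ Substructure.closure L (∅ : Set N) := by
  rw [← Set.image_empty f, ← Embedding.coe_toHom, Substructure.closure_image]
  exact mem_map_of_mem f.toHom h

/-! ### Transfer of the five properties -/

section Transfer

variable {κ μ : Cardinal.{u}}

theorem mem_Ico_of_isEmpty (hμ : μ < κ) {M : Type u} [IsEmpty M] (h : μ ≤ #M) :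
    #M ∈ Set.Ico μ κ :=
  ⟨h, by rw [mk_eq_zero]; exact zero_le.trans_lt hμ⟩

theorem AP.of_Ico (hκ : IsStronglyCompact κ) (hLS : K.lsNumber < κ) (hμ : μ < κ)
    (h : K.AP (Set.Ico μ κ)) : K.AP (Set.Ici μ) := by
  intro M₀ M₁ M₂ _ _ _ hM₀ hM₁ hM₂ hμ₀ hμ₁ hμ₂ f₁ f₂ hf₁ hf₂
  by_cases hne : Nonempty M₁ ∨ Nonempty M₂
  · obtain ⟨N, _, g₁, g₂, hg₁, hg₂, -, hg⟩ := amalgamation_of_isStrongCard hκ hLS hμ hM₀ hM₁ hM₂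
      hμ₀ hμ₁ hμ₂ hne (E := fun _ _ => True) f₁ f₂ fun A₀ A₁ A₂ hA₀ hA₁ hA₂ h₁ h₂ => by
        obtain ⟨N, _, g₁, g₂, hg₁, hg₂, hg⟩ := h A₀ A₁ A₂ (K.mod_of_strong _ hA₀.1).1
          (K.mod_of_strong _ hA₁.1).1 (K.mod_of_strong _ hA₂.1).1 hA₀.2.1 hA₁.2.1 hA₂.2.1 _ _
          (isKEmbedding_codRestrict hf₁ hA₀.1 hA₁.1 h₁)
          (isKEmbedding_codRestrict hf₂ hA₀.1 hA₂.1 h₂)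
        exact ⟨N, _, g₁, g₂, hg₁, hg₂, fun _ _ _ => trivial, fun a => DFunLike.congr_fun hg a⟩
    exact ⟨N, _, g₁, g₂, hg₁, hg₂, hg⟩
  -- With all models empty the ultraproduct argument lacks default values, but the cardinalities are
  -- `0 < κ` and the hypothesis applies directly.
  · simp only [not_or, not_nonempty_iff] at hne
    obtain ⟨_, _⟩ := hne
    have := Function.isEmpty f₁
    exact h M₀ M₁ M₂ hM₀ hM₁ hM₂ (mem_Ico_of_isEmpty hμ hμ₀) (mem_Ico_of_isEmpty hμ hμ₁)
      (mem_Ico_of_isEmpty hμ hμ₂) f₁ f₂ hf₁ hf₂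

theorem DAP.of_Ico (hκ : IsStronglyCompact κ) (hLS : K.lsNumber < κ) (hμ : μ < κ)
    (h : K.DAP (Set.Ico μ κ)) : K.DAP (Set.Ici μ) := by
  intro M₀ M₁ M₂ _ _ _ hM₀ hM₁ hM₂ hμ₀ hμ₁ hμ₂ f₁ f₂ hf₁ hf₂
  by_cases hne : Nonempty M₁ ∨ Nonempty M₂
  · obtain ⟨N, _, g₁, g₂, hg₁, hg₂, hE, hg⟩ := amalgamation_of_isStrongCard hκ hLS hμ hM₀ hM₁ hM₂
      -- Disjointness over the small base `A₀` weakens to the condition that `a` come from `M₀`,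
      -- which no longer depends on the index.
      hμ₀ hμ₁ hμ₂ hne (E := fun a _ => a ∈ Set.range f₁) f₁ f₂
      fun A₀ A₁ A₂ hA₀ hA₁ hA₂ h₁ h₂ => by
        obtain ⟨N, _, g₁, g₂, hg₁, hg₂, hg, hd⟩ := h A₀ A₁ A₂ (K.mod_of_strong _ hA₀.1).1
          (K.mod_of_strong _ hA₁.1).1 (K.mod_of_strong _ hA₂.1).1 hA₀.2.1 hA₁.2.1 hA₂.2.1 _ _
          (isKEmbedding_codRestrict hf₁ hA₀.1 hA₁.1 h₁)
          (isKEmbedding_codRestrict hf₂ hA₀.1 hA₂.1 h₂)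
        refine ⟨N, _, g₁, g₂, hg₁, hg₂, fun a b hab => ?_, fun a => DFunLike.congr_fun hg a⟩
        obtain ⟨m, hm⟩ := hd.subset ⟨⟨a, rfl⟩, ⟨b, hab.symm⟩⟩
        exact ⟨m, congrArg Subtype.val (g₁.injective hm)⟩
    refine ⟨N, _, g₁, g₂, hg₁, hg₂, hg, Set.Subset.antisymm ?_ ?_⟩
    · rintro _ ⟨⟨a, rfl⟩, ⟨b, hb⟩⟩
      obtain ⟨m, rfl⟩ := hE a b hb.symm
      exact ⟨m, rfl⟩
    · rintro _ ⟨m, rfl⟩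
      exact ⟨⟨f₁ m, rfl⟩, ⟨f₂ m, (DFunLike.congr_fun hg m).symm⟩⟩
  · simp only [not_or, not_nonempty_iff] at hne
    obtain ⟨_, _⟩ := hne
    have := Function.isEmpty f₁
    exact h M₀ M₁ M₂ hM₀ hM₁ hM₂ (mem_Ico_of_isEmpty hμ hμ₀) (mem_Ico_of_isEmpty hμ hμ₁)
      (mem_Ico_of_isEmpty hμ hμ₂) f₁ f₂ hf₁ hf₂

theorem JEP.of_Ico (hκ : IsStronglyCompact κ) (hLS : K.lsNumber < κ) (hμ : μ < κ)
    (h : K.JEP (Set.Ico μ κ)) : K.JEP (Set.Ici μ) := by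
  intro M₁ M₂ _ _ hM₁ hM₂ hμ₁ hμ₂
  by_cases hne : Nonempty M₁ ∨ Nonempty M₂
  · obtain ⟨N, _, g₁, g₂, hg₁, hg₂, -⟩ := joint_embedding_of_isStrongCard hκ hLS hμ hM₁ hM₂
      hμ₁ hμ₂ hne (E := fun _ _ => True) fun A₁ A₂ hA₁ hA₂ => by
        obtain ⟨N, _, g₁, g₂, hg₁, hg₂⟩ := h A₁ A₂ (K.mod_of_strong _ hA₁.1).1
          (K.mod_of_strong _ hA₂.1).1 hA₁.2.1 hA₂.2.1
        exact ⟨N, _, g₁, g₂, hg₁, hg₂, fun _ _ _ => trivial⟩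
    exact ⟨N, _, g₁, g₂, hg₁, hg₂⟩
  · simp only [not_or, not_nonempty_iff] at hne
    obtain ⟨_, _⟩ := hne
    exact h M₁ M₂ hM₁ hM₂ (mem_Ico_of_isEmpty hμ hμ₁) (mem_Ico_of_isEmpty hμ hμ₂)

theorem DJEP.of_Ico (hκ : IsStronglyCompact κ) (hLS : K.lsNumber < κ) (hμ : μ < κ)
    (h : K.DJEP (Set.Ico μ κ)) : K.DJEP (Set.Ici μ) := by
  intro M₁ M₂ _ _ hM₁ hM₂ hμ₁ hμ₂
  by_cases hne : Nonempty M₁ ∨ Nonempty M₂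
  · obtain ⟨N, _, g₁, g₂, hg₁, hg₂, hE⟩ := joint_embedding_of_isStrongCard hκ hLS hμ hM₁ hM₂
      hμ₁ hμ₂ hne (E := fun _ _ => False) fun A₁ A₂ hA₁ hA₂ => by
        obtain ⟨N, _, g₁, g₂, hg₁, hg₂, hd⟩ := h A₁ A₂ (K.mod_of_strong _ hA₁.1).1
          (K.mod_of_strong _ hA₂.1).1 hA₁.2.1 hA₂.2.1
        exact ⟨N, _, g₁, g₂, hg₁, hg₂, fun a b hab =>
          Set.disjoint_left.1 hd ⟨a, rfl⟩ ⟨b, hab.symm⟩⟩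
    refine ⟨N, _, g₁, g₂, hg₁, hg₂, Set.disjoint_left.2 ?_⟩
    rintro _ ⟨a, rfl⟩ ⟨b, hb⟩
    exact hE a b hb.symm
  · simp only [not_or, not_nonempty_iff] at hne
    obtain ⟨_, _⟩ := hne
    exact h M₁ M₂ hM₁ hM₂ (mem_Ico_of_isEmpty hμ hμ₁) (mem_Ico_of_isEmpty hμ hμ₂)

theorem NDJEP.of_Ico (hκ : IsStronglyCompact κ) (hLS : K.lsNumber < κ) (hμ : μ < κ)
    (h : K.NDJEP (Set.Ico μ κ)) : K.NDJEP (Set.Ici μ) := by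
  intro M₁ M₂ _ _ hM₁ hM₂ hμ₁ hμ₂
  by_cases hne : Nonempty M₁ ∨ Nonempty M₂
  · obtain ⟨N, _, g₁, g₂, hg₁, hg₂, hE⟩ := joint_embedding_of_isStrongCard hκ hLS hμ hM₁ hM₂
      hμ₁ hμ₂ hne (E := fun a _ => a ∈ Substructure.closure L (∅ : Set M₁)) fun A₁ A₂ hA₁ hA₂ => by
        obtain ⟨N, _, g₁, g₂, hg₁, hg₂, hd⟩ := h A₁ A₂ (K.mod_of_strong _ hA₁.1).1
          (K.mod_of_strong _ hA₂.1).1 hA₁.2.1 hA₂.2.1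
        exact ⟨N, _, g₁, g₂, hg₁, hg₂, fun a b hab => apply_mem_closure_empty A₁.subtype
          (mem_closure_empty_of_apply g₁ (hd ⟨⟨a, rfl⟩, ⟨b, hab.symm⟩⟩))⟩
    refine ⟨N, _, g₁, g₂, hg₁, hg₂, ?_⟩
    rintro _ ⟨⟨a, rfl⟩, ⟨b, hb⟩⟩
    exact apply_mem_closure_empty g₁ (hE a b hb.symm)
  · simp only [not_or, not_nonempty_iff] at hne
    obtain ⟨_, _⟩ := hne
    exact h M₁ M₂ hM₁ hM₂ (mem_Ico_of_isEmpty hμ hμ₁) (mem_Ico_of_isEmpty hμ hμ₂)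

end Transfer

end AEC

theorem theorem1p1 (L : FirstOrder.Language.{u, u}) (K : AEC L) (κ μ : Cardinal.{u})
    (hκ : IsStronglyCompact κ) (hLS : K.lsNumber < κ) (hμ : μ < κ) :
    (K.AP (Set.Ico μ κ) → K.AP (Set.Ici μ)) ∧
    (K.JEP (Set.Ico μ κ) → K.JEP (Set.Ici μ)) ∧
    (K.DAP (Set.Ico μ κ) → K.DAP (Set.Ici μ)) ∧
    (K.DJEP (Set.Ico μ κ) → K.DJEP (Set.Ici μ)) ∧
    (K.NDJEP (Set.Ico μ κ) → K.NDJEP (Set.Ici μ)) :=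
  ⟨AEC.AP.of_Ico hκ hLS hμ, AEC.JEP.of_Ico hκ hLS hμ, AEC.DAP.of_Ico hκ hLS hμ,
    AEC.DJEP.of_Ico hκ hLS hμ, AEC.NDJEP.of_Ico hκ hLS hμ⟩
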